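/- Let $P=(P(i,j))_{i,j\in S}$ be the transition matrix of a stochastic, irreducible and aperiodic homogeneous discrete-time Markov chain $\mathcal X=\{X(n),\ n=0,1,\ldots\}$ on a countably infinite state space $S$, and write $P^{(n)}=P^n$. For $m\ge 1$ let $\mathcal X^{(m)}=\{X(km),\ k=0,1,\ldots\}$ be the $m$-step chain. All "almost sure" statements below are meant for every initial state (by irreducibility and aperiodicity they do not depend on it). For $C\subset S$ let $U^{(m)}(C)$ be the event that $X(km)\in C$ for infinitely many $k$, and $L^{(m)}(C)$ the event that $X(km)\in C$ for all sufficiently large $k$. With respect to $\mathcal X^{(m)}$, the set $C$ is *almost closed* if $\mathbb P(U^{(m)}(C))>0$ and $U^{(m)}(C)=L^{(m)}(C)$ almost surely; an almost closed set is *atomic* if it does not contain two disjoint almost closed subsets. A *Blackwell decomposition* for $\mathcal X^{(m)}$ is a finite or countable collection $\{C_1,C_2,\ldots\}$ of disjoint almost closed sets such that every $C_i$, except at most one, is atomic; the nonatomic $C_i$, if present, contains no atomic subsets and consists of transient states; and $\sum_i\mathbb P(L^{(m)}(C_i))=1$. By a theorem of Blackwell such a decomposition exists and is unique up to changes of the sets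 by transient sets; $\beta(\mathcal X^{(m)})\in\{1,2,\ldots,\infty\}$ denotes its number of sets. $\mathcal X^{(m)}$ is called *simple* if $\beta(\mathcal X^{(m)})=1$. The *asymptotic period* of a simple chain $\mathcal X=\mathcal X^{(1)}$ is $$d(\mathcal X)=\sup\{m\ge 1 \mid \beta(\mathcal X^{(m)})=m\}\in\{1,2,\ldots,\infty\},$$ and $\mathcal X$ is *asymptotically aperiodic* if $d(\mathcal X)=1$. For $n\ge1$ consider the condition $(\ast)_n$: there exists a constant $\delta>0$ such that $P^{(n)}(i,i)\ge\delta$ for all but finitely many states $i\in S$. **Theorem.** Let $\mathcal X$ be simple. 1. If $(\ast)_n$ holds for some $n\ge 1$, then $d(\mathcal X)$ is finite and is a divisor of $n$. 2. If there is a $\delta>0$ such that $P(i,i)\ge\delta$ for all but finitely many states $i\in S$, then $\mathcal X$ is asymptotically aperiodic. 3. If, for some $n\ge1$, $(\ast)_n$ holds and $\mathcal X^{(n)}$ is simple, then $\mathcal X$ is asymptotically aperiodic. -/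

import Mathlib

open MeasureTheory ProbabilityTheory
open scoped ENNReal

namespace AsymptoticPeriod

noncomputable section

/-- The `n`-step transition probabilities of the homogeneous chain with (stochastic) transition
matrix `P`; `P i j` is the probability of jumping from `i` to `j`. -/
def nStep {S : Type*} (P : S → PMF S) : ℕ → S → PMF S
  | 0 => fun i => PMF.pure i
  | n + 1 => fun i => (nStep P n i).bind P

/-- Every state can be reached from every state. -/
def IsIrreducible {S : Type*} (P : S → PMF S) : Prop :=
  ∀ i j, ∃ n : ℕ, 0 < nStep P n i j

/-- For every state `i`, the greatest common divisor of `{n ≥ 1 | P⁽ⁿ⁾(i,i) > 0}` equals `1`. -/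
def IsAperiodic {S : Type*} (P : S → PMF S) : Prop :=
  ∀ i, ∀ d : ℕ, (∀ n : ℕ, 1 ≤ n → 0 < nStep P n i i → d ∣ n) → d = 1

section Paths

variable {S : Type*} [MeasurableSpace S] [DiscreteMeasurableSpace S] [Countable S]

/-- The conditional law of `X (n + 1)` given the history `X 0, …, X n`: it is `P (X n) ·`. -/
def historyKernel (P : S → PMF S) (n : ℕ) : Kernel ((i : Finset.Iic n) → S) S where
  toFun h := (P (h ⟨n, Finset.mem_Iic.2 le_rfl⟩)).toMeasure
  measurable' :=
    (Measurable.of_discrete (f := fun s : S => (P s).toMeasure)).comp (measurable_pi_apply _)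

instance (P : S → PMF S) (n : ℕ) : IsMarkovKernel (historyKernel P n) :=
  ⟨fun h => inferInstanceAs
    (IsProbabilityMeasure (P (h ⟨n, Finset.mem_Iic.2 le_rfl⟩)).toMeasure)⟩

/-- The law on the space `ℕ → S` of sample paths of the chain with transition matrix `P`
started in the state `i` (obtained from the Ionescu-Tulcea theorem). -/
def pathLaw (P : S → PMF S) (i : S) : Measure (ℕ → S) :=
  Kernel.traj (X := fun _ : ℕ => S) (historyKernel P) 0 (fun _ => i)

instance (P : S → PMF S) (i : S) : IsProbabilityMeasure (pathLaw P i) :=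
  inferInstanceAs (IsProbabilityMeasure
    (Kernel.traj (X := fun _ : ℕ => S) (historyKernel P) 0 (fun _ => i)))

end Paths

/-- The event `U⁽ᵐ⁾(C)` that the `m`-step chain `X⁽ᵐ⁾(k) = X(k m)` is in `C` infinitely often. -/
def evU {S : Type*} (m : ℕ) (C : Set S) : Set (ℕ → S) :=
  {ω | ∀ n : ℕ, ∃ k : ℕ, n ≤ k ∧ ω (k * m) ∈ C}

/-- The event `L⁽ᵐ⁾(C)` that the `m`-step chain `X⁽ᵐ⁾(k) = X(k m)` is in `C` for all
sufficiently large `k`. -/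
def evL {S : Type*} (m : ℕ) (C : Set S) : Set (ℕ → S) :=
  {ω | ∃ n : ℕ, ∀ k : ℕ, n ≤ k → ω (k * m) ∈ C}

/-! In the following definitions the natural number `m` says that the notion is taken
with respect to the `m`-step chain `X⁽ᵐ⁾`; for `m = 1` this is the chain itself. "Almost surely"
is understood for every initial state. -/

section Blackwell

variable {S : Type*} [MeasurableSpace S] [DiscreteMeasurableSpace S] [Countable S]

/-- `C` is transient: almost surely `C` is visited only finitely often. -/
def IsTransientSet (P : S → PMF S) (m : ℕ) (C : Set S) : Prop :=
  ∀ i, pathLaw P i (evU m C) = 0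

/-- `C` is regular: the events `U(C)` and `L(C)` are almost surely equal. -/
def IsRegularSet (P : S → PMF S) (m : ℕ) (C : Set S) : Prop :=
  ∀ i, evU m C =ᵐ[pathLaw P i] evL m C

/-- `C` is almost closed: regular and not transient. -/
def IsAlmostClosed (P : S → PMF S) (m : ℕ) (C : Set S) : Prop :=
  ¬ IsTransientSet P m C ∧ IsRegularSet P m C

/-- `C` is an atomic almost closed set: it does not contain two disjoint almost closed subsets. -/
def IsAtomicSet (P : S → PMF S) (m : ℕ) (C : Set S) : Prop :=
  IsAlmostClosed P m C ∧
    ¬ ∃ A B : Set S, A ⊆ C ∧ B ⊆ C ∧ Disjoint A B ∧ IsAlmostClosed P m A ∧ IsAlmostClosed P m B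

/-- The state `i` is transient: the chain started in `i` almost surely visits `i` only
finitely often. -/
def IsTransientState (P : S → PMF S) (m : ℕ) (i : S) : Prop :=
  pathLaw P i (evU m {i}) = 0

/-- A Blackwell decomposition: a finite or countable collection of disjoint almost closed sets,
all but at most one of them atomic, the nonatomic one (if present) containing no atomic subsets
and consisting of transient states, such that the probabilities of ultimately remaining in one
of the sets sum to `1`. -/
structure IsBlackwellDecomposition (P : S → PMF S) (m : ℕ) (𝒞 : Set (Set S)) : Prop where
  countable : 𝒞.Countable
  disjoint : 𝒞.PairwiseDisjoint id
  almostClosed : ∀ C ∈ 𝒞, IsAlmostClosed P m C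
  atomic : ∀ C ∈ 𝒞, ∀ D ∈ 𝒞, ¬ IsAtomicSet P m C → ¬ IsAtomicSet P m D → C = D
  nonatomic : ∀ C ∈ 𝒞, ¬ IsAtomicSet P m C →
    (∀ A : Set S, A ⊆ C → ¬ IsAtomicSet P m A) ∧ ∀ i ∈ C, IsTransientState P m i
  sum_eq_one : ∀ i, ∑' C : 𝒞, pathLaw P i (evL m (C : Set S)) = 1

/-- `β(X⁽ᵐ⁾)`: the number (in `ℕ∞`) of sets in a Blackwell decomposition for `X⁽ᵐ⁾`. The
decomposition is unique up to equivalence, so that all decompositions have the same number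
of sets, and the infimum merely picks that common value. -/
def beta (P : S → PMF S) (m : ℕ) : ℕ∞ :=
  ⨅ (𝒞 : Set (Set S)) (_ : IsBlackwellDecomposition P m 𝒞), 𝒞.encard

/-- The `m`-step chain `X⁽ᵐ⁾` is simple. -/
def IsSimple (P : S → PMF S) (m : ℕ) : Prop :=
  beta P m = 1

/-- The asymptotic period `d(X) = sup {m ≥ 1 | β(X⁽ᵐ⁾) = m}`, possibly infinite. -/
def asymptoticPeriod (P : S → PMF S) : ℕ∞ :=
  ⨆ (m : ℕ) (_ : 1 ≤ m ∧ beta P m = (m : ℕ∞)), (m : ℕ∞)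

/-- The chain is asymptotically aperiodic. -/
def IsAsymptoticallyAperiodic (P : S → PMF S) : Prop :=
  asymptoticPeriod P = 1

end Blackwell

/-- There is `δ > 0` such that `P⁽ⁿ⁾(i,i) ≥ δ` for all but finitely many states `i`. -/
def ReturnBound {S : Type*} (P : S → PMF S) (n : ℕ) : Prop :=
  ∃ δ : ℝ≥0∞, 0 < δ ∧ {i : S | ¬ δ ≤ nStep P n i i}.Finite

end

end AsymptoticPeriod

namespace AsymptoticPeriod

open Filter Topology Preorder

/-! ### Path laws and the Markov property -/

section Markov

/-! Almost closed sets for the `m`-step chain correspond to nonnull events invariant under the time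
shift by `m`: by Lévy's zero-one law such an event `A` is the event of ultimately staying in `{i |
1/2 < P_i(A)}` (`InvEvent.exists_set`).

The key point is `InvEvent.le_shift`. Along the path, `P_{X(km)}(A)` tends to the indicator of `A`,
and likewise for `A` shifted by `n`. The return bound makes the second probability at least `δ`
times the first off a finite set, so `A` lies in its shift. Applied to the complement too, this
makes `A` invariant under `n`, hence under `g = gcd(m, n)`.

When shift-invariant events are trivial, at most `g` almost disjoint nonnull events can be
`g`-invariant (`card_le_of_disjoint_invEvents`). If `β(X⁽ᵐ⁾) = m ≥ 2`, an atomic set exists and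
simplicity forces this triviality; the `m` Blackwell sets then give `m ≤ gcd(m, n)`, so `m ∣ n`. If
moreover `X⁽ⁿ⁾` is simple, the `n`-invariant events are either trivial, excluding two Blackwell
sets, or atomless, yielding more than `n` disjoint pieces; so `d ≥ 2` is impossible. -/

lemma measurableSet_eval {S : Type*} [MeasurableSpace S] [MeasurableSingletonClass S]
    (n : ℕ) (j : S) : MeasurableSet {x : ℕ → S | x n = j} :=
  (measurable_pi_apply (X := fun _ : ℕ => S) n) (MeasurableSet.singleton j)

lemma ext_of_cylinder {S : Type*} [MeasurableSpace S] [Countable S]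
    [MeasurableSingletonClass S] {μ ν : Measure (ℕ → S)} [IsFiniteMeasure μ]
    (h : ∀ (s : ℕ → S) (n : ℕ), μ {x | ∀ k ≤ n, x k = s k} = ν {x | ∀ k ≤ n, x k = s k})
    (huniv : μ Set.univ = ν Set.univ) : μ = ν := by
  refine ext_of_generate_finite (measurableCylinders fun _ : ℕ => S)
    generateFrom_measurableCylinders.symm isPiSystem_measurableCylinders ?_ huniv
  intro A hA
  rw [measurableCylinders_nat] at hA
  simp only [Set.mem_iUnion, Set.mem_singleton_iff] at hA
  obtain ⟨n, E, hE, rfl⟩ := hA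
  have hm : Measurable (frestrictLe (π := fun _ : ℕ => S) n) := by fun_prop
  have key : μ.map (frestrictLe (π := fun _ : ℕ => S) n) =
      ν.map (frestrictLe (π := fun _ : ℕ => S) n) := by
    refine Measure.ext_of_singleton fun t => ?_
    rw [Measure.map_apply hm (MeasurableSet.singleton t),
      Measure.map_apply hm (MeasurableSet.singleton t)]
    -- The hypothesis needs an infinite sequence, so `t` is prolonged by its last value.
    have h1 : frestrictLe (π := fun _ : ℕ => S) n ⁻¹' {t} =
        {x | ∀ k ≤ n, x k = t ⟨min k n, Finset.mem_Iic.2 (min_le_right _ _)⟩} := by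
      ext x
      simp only [Set.mem_preimage, Set.mem_singleton_iff, funext_iff, frestrictLe_apply,
        Set.mem_ofPred_eq, Subtype.forall, Finset.mem_Iic]
      refine forall₂_congr fun k hk => ?_
      simp [min_eq_left hk]
    rw [h1]
    exact h _ n
  have := congrArg (fun ρ => ρ E) key
  simp only [Measure.map_apply hm hE] at this
  exact this

/-- Time shift on paths. -/
def shift {S : Type*} (n : ℕ) (x : ℕ → S) : ℕ → S := fun k => x (n + k)

lemma measurable_shift {S : Type*} [MeasurableSpace S] (n : ℕ) :
    Measurable (shift n : (ℕ → S) → ℕ → S) :=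
  measurable_pi_lambda _ fun _ => measurable_pi_apply _


variable {S : Type*} [MeasurableSpace S] [DiscreteMeasurableSpace S] [Countable S]

/-- Probability that a path starting in `i` begins with `s 0, …, s n`. -/
noncomputable def pathWeight (P : S → PMF S) (i : S) (n : ℕ) (s : ℕ → S) : ℝ≥0∞ :=
  PMF.pure i (s 0) * ∏ k ∈ Finset.range n, P (s k) (s (k + 1))

lemma traj_step (P : S → PMF S) {b c : ℕ} (hbc : b ≤ c) (h : (i : Finset.Iic b) → S)
    (E : Set ((i : Finset.Iic c) → S)) (u v : S)
    (hE : ∀ y ∈ E, y ⟨c, Finset.mem_Iic.2 le_rfl⟩ = u) :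
    Kernel.traj (X := fun _ : ℕ => S) (historyKernel P) b h
        (frestrictLe (π := fun _ : ℕ => S) c ⁻¹' E ∩ {x | x (c + 1) = v}) =
      Kernel.traj (X := fun _ : ℕ => S) (historyKernel P) b h
        (frestrictLe (π := fun _ : ℕ => S) c ⁻¹' E) * P u v := by
  have hEm : MeasurableSet E := E.to_countable.measurableSet
  have h1 : frestrictLe (π := fun _ : ℕ => S) c ⁻¹' E ∩ {x : ℕ → S | x (c + 1) = v} =
      (fun x : ℕ → S => (frestrictLe (π := fun _ : ℕ => S) c x, x (c + 1))) ⁻¹' (E ×ˢ {v}) := by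
    ext x; simp
  rw [h1, ← Measure.map_apply (by fun_prop) (hEm.prod (MeasurableSet.singleton v)),
    ← Kernel.partialTraj_compProd_eq_map_traj hbc,
    Measure.compProd_apply_prod hEm (MeasurableSet.singleton v)]
  have h2 : ∀ y ∈ E, historyKernel P c y {v} = P u v := by
    intro y hy
    change (P (y ⟨c, _⟩)).toMeasure {v} = _
    rw [hE y hy, PMF.toMeasure_apply_singleton _ _ (MeasurableSet.singleton v)]
  rw [setLIntegral_congr_fun hEm h2, setLIntegral_const, mul_comm,
    ← Kernel.traj_map_frestrictLe_apply, Measure.map_apply (by fun_prop) hEm]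

lemma traj_cylinder (P : S → PMF S) (b : ℕ) (h : (i : Finset.Iic b) → S) (s : ℕ → S) (n : ℕ) :
    Kernel.traj (X := fun _ : ℕ => S) (historyKernel P) b h {x | ∀ k ≤ n, x (b + k) = s k} =
      pathWeight P (h ⟨b, Finset.mem_Iic.2 le_rfl⟩) n s := by
  induction n with
  | zero =>
    have h1 : {x : ℕ → S | ∀ k ≤ 0, x (b + k) = s k} =
        frestrictLe (π := fun _ : ℕ => S) b ⁻¹' {y | y ⟨b, Finset.mem_Iic.2 le_rfl⟩ = s 0} := by
      ext x; simp
    have hm : MeasurableSet {y : (i : Finset.Iic b) → S | y ⟨b, Finset.mem_Iic.2 le_rfl⟩ = s 0} :=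
      (Set.to_countable _).measurableSet
    rw [h1, ← Measure.map_apply (by fun_prop) hm, Kernel.traj_map_frestrictLe_apply,
      Kernel.partialTraj_self, Kernel.id_apply, Measure.dirac_apply' _ hm]
    by_cases hs : s 0 = h ⟨b, Finset.mem_Iic.2 le_rfl⟩
    · simp [pathWeight, hs, PMF.pure_apply]
    · simp [pathWeight, hs, Ne.symm hs, PMF.pure_apply]
  | succ n ih =>
    have h1 : {x : ℕ → S | ∀ k ≤ n + 1, x (b + k) = s k} =
        frestrictLe (π := fun _ : ℕ => S) (b + n) ⁻¹'
          {y | ∀ k (hk : k ≤ n), y ⟨b + k, Finset.mem_Iic.2 (by lia)⟩ = s k} ∩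
          {x | x (b + n + 1) = s (n + 1)} := by
      ext x
      simp only [Set.mem_ofPred_eq, Set.mem_inter_iff, Set.mem_preimage, frestrictLe_apply]
      constructor
      · exact fun hx => ⟨fun k hk => hx k (by lia), hx (n + 1) le_rfl⟩
      · rintro ⟨hx, hx'⟩ k hk
        rcases Nat.lt_or_ge n k with h | h
        · obtain rfl : k = n + 1 := by lia
          exact hx'
        · exact hx k h
    have h2 : frestrictLe (π := fun _ : ℕ => S) (b + n) ⁻¹'
          {y | ∀ k (hk : k ≤ n), y ⟨b + k, Finset.mem_Iic.2 (by lia)⟩ = s k} =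
        {x : ℕ → S | ∀ k ≤ n, x (b + k) = s k} := by
      ext x; simp
    rw [h1, traj_step P (Nat.le_add_right b n) h _ (s n) (s (n + 1)), h2, ih,
      pathWeight, pathWeight, Finset.prod_range_succ, mul_assoc]
    exact fun y hy => hy n le_rfl

/-- Both laws give cylinders the same `pathWeight`, which sees the history only through its last
state. -/
lemma traj_map_shift (P : S → PMF S) (b : ℕ) (h : (i : Finset.Iic b) → S) :
    (Kernel.traj (X := fun _ : ℕ => S) (historyKernel P) b h).map (shift b) =
      pathLaw P (h ⟨b, Finset.mem_Iic.2 le_rfl⟩) := by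
  have : IsProbabilityMeasure
      ((Kernel.traj (X := fun _ : ℕ => S) (historyKernel P) b h).map (shift b)) :=
    Measure.isProbabilityMeasure_map (measurable_shift b).aemeasurable
  refine ext_of_cylinder (fun s n => ?_) (by simp)
  have hm : MeasurableSet {x : ℕ → S | ∀ k ≤ n, x k = s k} := by
    have : {x : ℕ → S | ∀ k ≤ n, x k = s k} = ⋂ k, ⋂ (_ : k ≤ n), {x | x k = s k} := by
      ext x; simp
    rw [this]
    exact .iInter fun k => .iInter fun _ => measurableSet_eval k (s k)
  rw [Measure.map_apply (measurable_shift b) hm, pathLaw]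
  have := traj_cylinder P 0 (fun _ => h ⟨b, Finset.mem_Iic.2 le_rfl⟩) s n
  simp only [zero_add] at this
  rw [this]
  exact traj_cylinder P b h s n

/-- **Markov property**. -/
lemma condExp_shift (P : S → PMF S) (i : S) (n : ℕ) {A : Set (ℕ → S)} (hA : MeasurableSet A) :
    (pathLaw P i)[(shift n ⁻¹' A).indicator (fun _ => (1 : ℝ)) |
        Filtration.piLE (X := fun _ : ℕ => S) n] =ᵐ[pathLaw P i]
      fun x => (pathLaw P (x n)).real A := by
  have hA' := measurable_shift n hA
  refine (Kernel.condExp_traj (X := fun _ : ℕ => S) (κ := historyKernel P) (Nat.zero_le n)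
    ((integrable_const (1 : ℝ)).indicator hA')).trans (Eventually.of_forall fun x => ?_)
  simp only
  rw [integral_indicator_const _ hA', smul_eq_mul, mul_one, measureReal_def, measureReal_def,
    ← Measure.map_apply (measurable_shift n) hA, traj_map_shift]
  rfl

lemma pathLaw_shift_preimage (P : S → PMF S) (i : S) (n : ℕ) {A : Set (ℕ → S)}
    (hA : MeasurableSet A) :
    pathLaw P i (shift n ⁻¹' A) = ∫⁻ x, pathLaw P (x n) A ∂(pathLaw P i) := by
  have h1 := Kernel.traj_comp_partialTraj (X := fun _ : ℕ => S) (κ := historyKernel P) (Nat.zero_le n)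
  have h2 : pathLaw P i (shift n ⁻¹' A) = ∫⁻ y : Finset.Iic n → S, pathLaw P (y ⟨n, Finset.mem_Iic.2 le_rfl⟩) A
      ∂(Kernel.partialTraj (X := fun _ : ℕ => S) (historyKernel P) 0 n (fun _ => i)) := by
    rw [pathLaw, ← h1, Kernel.comp_apply' _ _ _ (measurable_shift n hA)]
    refine lintegral_congr fun y => ?_
    rw [← traj_map_shift, Measure.map_apply (measurable_shift n) hA]
  rw [h2, ← Kernel.traj_map_frestrictLe_apply, lintegral_map Measurable.of_discrete (by fun_prop)]
  rfl

lemma pathLaw_eval (P : S → PMF S) (i : S) (n : ℕ) (j : S) :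
    pathLaw P i {x | x n = j} = nStep P n i j := by
  induction n generalizing j with
  | zero =>
    have := traj_cylinder P 0 (fun _ => i) (fun _ => j) 0
    simp only [nonpos_iff_eq_zero, forall_eq, add_zero] at this
    rw [pathLaw, this]
    simp [pathWeight, nStep]
  | succ n ih =>
    have h1 : {x : ℕ → S | x (n + 1) = j} =
        ⋃ u : S, ({x | x n = u} ∩ {x | x (n + 1) = j}) := by
      ext x; simp
    rw [h1, measure_iUnion _ (fun u => (measurableSet_eval _ _).inter (measurableSet_eval _ _))]
    · simp only [nStep, PMF.bind_apply]
      refine tsum_congr fun u => ?_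
      rw [← ih u]
      exact traj_step P (Nat.zero_le n) (fun _ => i)
        {y | y ⟨n, Finset.mem_Iic.2 le_rfl⟩ = u} u j (fun y hy => hy)
    · intro u v huv
      refine Set.disjoint_left.2 fun x hx hx' => huv ?_
      exact hx.1.symm.trans hx'.1

lemma pathLaw_shift_ge (P : S → PMF S) (i : S) (n : ℕ) (j : S) {A : Set (ℕ → S)}
    (hA : MeasurableSet A) :
    nStep P n i j * pathLaw P j A ≤ pathLaw P i (shift n ⁻¹' A) := by
  rw [pathLaw_shift_preimage P i n hA, ← pathLaw_eval, mul_comm, ← setLIntegral_const]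
  refine le_trans (le_of_eq ?_) (setLIntegral_le_lintegral {x : ℕ → S | x n = j} _)
  refine setLIntegral_congr_fun (measurableSet_eval n j) fun x hx => ?_
  rw [show x n = j from hx]

end Markov

/-! ### Invariant events and almost closed sets -/

section Events

variable {S : Type*} [MeasurableSpace S] [DiscreteMeasurableSpace S] [Countable S]

/-- A measure whose null sets are the sets which are null for every initial state. -/
noncomputable def pathMeasure (P : S → PMF S) : Measure (ℕ → S) := Measure.sum (pathLaw P)

lemma pathMeasure_eq_zero {P : S → PMF S} {A : Set (ℕ → S)} :
    pathMeasure P A = 0 ↔ ∀ i, pathLaw P i A = 0 :=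
  Measure.sum_apply_eq_zero

lemma ae_pathMeasure {P : S → PMF S} {p : (ℕ → S) → Prop} :
    (∀ᵐ x ∂pathMeasure P, p x) ↔ ∀ i, ∀ᵐ x ∂pathLaw P i, p x :=
  Measure.ae_sum_iff

lemma ae_eq_pathMeasure {P : S → PMF S} {A B : Set (ℕ → S)} :
    A =ᵐ[pathMeasure P] B ↔ ∀ i, A =ᵐ[pathLaw P i] B :=
  Measure.ae_sum_iff

lemma pathLaw_absolutelyContinuous (P : S → PMF S) (i : S) : pathLaw P i ≪ pathMeasure P :=
  Measure.AbsolutelyContinuous.mk fun _ _ h => pathMeasure_eq_zero.1 h i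

lemma quasiMeasurePreserving_shift (P : S → PMF S) (n : ℕ) :
    Measure.QuasiMeasurePreserving (shift n) (pathMeasure P) (pathMeasure P) := by
  refine ⟨measurable_shift n, Measure.AbsolutelyContinuous.mk fun A hA h => ?_⟩
  rw [Measure.map_apply (measurable_shift n) hA, pathMeasure_eq_zero]
  intro i
  rw [pathLaw_shift_preimage P i n hA]
  simp [pathMeasure_eq_zero.1 h]

lemma shift_zero {S : Type*} (x : ℕ → S) : shift 0 x = x := by
  funext k; simp [shift]

lemma shift_preimage_shift {S : Type*} (a b : ℕ) (A : Set (ℕ → S)) :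
    shift a ⁻¹' (shift b ⁻¹' A) = shift (b + a) ⁻¹' A := by
  ext x
  simp only [Set.mem_preimage]
  have : shift b (shift a x) = shift (b + a) x := by
    funext k; simp only [shift]; congr 1; lia
  rw [this]

/-- Events almost surely invariant under the shift by `m`. -/
structure InvEvent (P : S → PMF S) (m : ℕ) (A : Set (ℕ → S)) : Prop where
  meas : MeasurableSet A
  inv : shift m ⁻¹' A =ᵐ[pathMeasure P] A

namespace InvEvent

variable {P : S → PMF S} {m n : ℕ} {A B : Set (ℕ → S)}

omit [Countable S] in
lemma univ : InvEvent P m Set.univ := ⟨.univ, by rfl⟩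

omit [Countable S] in
lemma compl (hA : InvEvent P m A) : InvEvent P m Aᶜ := ⟨hA.meas.compl, hA.inv.compl⟩

omit [Countable S] in
lemma inter (hA : InvEvent P m A) (hB : InvEvent P m B) : InvEvent P m (A ∩ B) :=
  ⟨hA.meas.inter hB.meas, hA.inv.inter hB.inv⟩

omit [Countable S] in
lemma diff (hA : InvEvent P m A) (hB : InvEvent P m B) : InvEvent P m (A \ B) :=
  hA.inter hB.compl

lemma preimage_shift (hA : InvEvent P m A) (j : ℕ) : InvEvent P m (shift j ⁻¹' A) := by
  refine ⟨measurable_shift j hA.meas, ?_⟩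
  rw [shift_preimage_shift, add_comm, ← shift_preimage_shift]
  exact (quasiMeasurePreserving_shift P j).preimage_ae_eq hA.inv

lemma add (hA : InvEvent P m A) (hA' : InvEvent P n A) : InvEvent P (m + n) A := by
  refine ⟨hA.meas, ?_⟩
  rw [← shift_preimage_shift]
  exact ((quasiMeasurePreserving_shift P n).preimage_ae_eq hA.inv).trans hA'.inv

lemma mul (hA : InvEvent P m A) (k : ℕ) : InvEvent P (k * m) A := by
  induction k with
  | zero =>
    refine ⟨hA.meas, ?_⟩
    have : shift (0 * m) ⁻¹' A = A := by
      ext x; simp [shift_zero]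
    rw [this]
    exact .rfl
  | succ k ih => rw [add_mul, one_mul]; exact ih.add hA

lemma of_dvd (hA : InvEvent P m A) (h : m ∣ n) : InvEvent P n A := by
  obtain ⟨k, rfl⟩ := h
  rw [mul_comm]
  exact hA.mul k

/-- The cancellation step that lets Euclid's algorithm run on the shifts preserving an event. -/
lemma of_add (hA : InvEvent P m A) (hA' : InvEvent P (n + m) A) : InvEvent P n A := by
  refine ⟨hA.meas, ?_⟩
  refine EventuallyEq.trans ?_ hA'.inv
  rw [add_comm, ← shift_preimage_shift]
  exact (quasiMeasurePreserving_shift P n).preimage_ae_eq hA.inv.symm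

lemma gcd (hm : InvEvent P m A) (hn : InvEvent P n A) : InvEvent P (m.gcd n) A := by
  induction m, n using Nat.gcd.induction with
  | H0 n => simpa using hn
  | H1 m n _ ih =>
    rw [Nat.gcd_rec]
    refine ih ?_ hm
    refine (hm.mul (n / m)).of_add ?_
    rw [mul_comm, Nat.mod_add_div]
    exact hn

end InvEvent

omit [DiscreteMeasurableSpace S] [Countable S] in
lemma iSup_piLE : (⨆ n, Filtration.piLE (X := fun _ : ℕ => S) n) =
    (MeasurableSpace.pi : MeasurableSpace (ℕ → S)) := by
  refine le_antisymm (iSup_le fun n => Filtration.le _ n) ?_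
  refine iSup_le fun n => le_trans ?_ (le_iSup (fun n => Filtration.piLE (X := fun _ : ℕ => S) n) n)
  rw [Filtration.piLE_eq_comap_frestrictLe]
  refine Measurable.comap_le ?_
  exact (measurable_pi_apply (⟨n, Finset.mem_Iic.2 le_rfl⟩ : Finset.Iic n)).comp
    (comap_measurable (Preorder.frestrictLe (π := fun _ : ℕ => S) n))

/-- **Lévy's zero-one law** for invariant events. -/
lemma InvEvent.tendsto_indicator {P : S → PMF S} {m : ℕ} {A : Set (ℕ → S)} (hm : 1 ≤ m)
    (hA : InvEvent P m A) :
    ∀ᵐ x ∂pathMeasure P, Tendsto (fun k : ℕ => (pathLaw P (x (k * m))).real A) atTop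
      (𝓝 (A.indicator (fun _ => 1) x)) := by
  refine ae_pathMeasure.2 fun i => ?_
  have hint : Integrable (A.indicator fun _ => (1 : ℝ)) (pathLaw P i) :=
    (integrable_const _).indicator hA.meas
  have hmeas : StronglyMeasurable[⨆ n, Filtration.piLE (X := fun _ : ℕ => S) n]
      (A.indicator fun _ => (1 : ℝ)) := by
    rw [iSup_piLE]
    exact stronglyMeasurable_const.indicator hA.meas
  have h1 := hint.tendsto_ae_condExp hmeas
  have h2 : ∀ᵐ x ∂pathLaw P i, ∀ k : ℕ,
      ((pathLaw P i)[A.indicator fun _ => (1 : ℝ) |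
        Filtration.piLE (X := fun _ : ℕ => S) (k * m)]) x = (pathLaw P (x (k * m))).real A := by
    refine ae_all_iff.2 fun k => ?_
    refine EventuallyEq.trans (condExp_congr_ae ?_) (condExp_shift P i (k * m) hA.meas)
    exact indicator_ae_eq_of_ae_eq_set
      ((pathLaw_absolutelyContinuous P i).ae_eq (hA.mul k).inv.symm)
  filter_upwards [h1, h2] with x hx1 hx2
  refine (hx1.comp (tendsto_id.atTop_mul_const' (by lia : 0 < m))).congr fun k => ?_
  exact hx2 k

lemma evL_subset_evU {S : Type*} (m : ℕ) (C : Set S) : evL m C ⊆ evU m C := by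
  rintro x ⟨n, hn⟩ k
  exact ⟨max k n, le_max_left _ _, hn _ (le_max_right _ _)⟩

lemma evU_mono {S : Type*} (m : ℕ) {C D : Set S} (h : C ⊆ D) : evU m C ⊆ evU m D := fun _ hx n =>
  let ⟨k, hk, hk'⟩ := hx n
  ⟨k, hk, h hk'⟩

lemma evL_inter {S : Type*} (m : ℕ) (C D : Set S) : evL m C ∩ evL m D = evL m (C ∩ D) := by
  ext x
  constructor
  · rintro ⟨⟨a, ha⟩, ⟨b, hb⟩⟩
    exact ⟨max a b, fun k hk => ⟨ha k (le_of_max_le_left hk), hb k (le_of_max_le_right hk)⟩⟩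
  · rintro ⟨a, ha⟩
    exact ⟨⟨a, fun k hk => (ha k hk).1⟩, ⟨a, fun k hk => (ha k hk).2⟩⟩

omit [Countable S] in
lemma measurableSet_evU (m : ℕ) (C : Set S) : MeasurableSet (evU m C) := by
  have : evU m C = ⋂ n : ℕ, ⋃ k : ℕ, ⋃ _ : n ≤ k, (fun x : ℕ → S => x (k * m)) ⁻¹' C := by
    ext x; simp [evU]
  rw [this]
  exact .iInter fun n => .iUnion fun k => .iUnion fun _ =>
    (measurable_pi_apply (X := fun _ : ℕ => S) _) (.of_discrete)

lemma shift_preimage_evU {S : Type*} (m : ℕ) (C : Set S) : shift m ⁻¹' evU m C = evU m C := by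
  ext x
  have key : ∀ k, shift m x (k * m) = x ((k + 1) * m) := fun k => by
    simp only [shift]; congr 1; ring
  constructor
  · intro hx n
    obtain ⟨k, hk, hk'⟩ := hx n
    exact ⟨k + 1, by lia, key k ▸ hk'⟩
  · intro hx n
    obtain ⟨k, hk, hk'⟩ := hx (n + 1)
    obtain ⟨k, rfl⟩ : ∃ l, k = l + 1 := ⟨k - 1, by lia⟩
    exact ⟨k, by lia, (key k).symm ▸ hk'⟩

omit [Countable S] in
lemma invEvent_evU (P : S → PMF S) (m : ℕ) (C : Set S) : InvEvent P m (evU m C) :=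
  ⟨measurableSet_evU m C, by rw [shift_preimage_evU]; exact .rfl⟩

lemma isAlmostClosed_iff {P : S → PMF S} {m : ℕ} {C : Set S} :
    IsAlmostClosed P m C ↔
      pathMeasure P (evU m C) ≠ 0 ∧ evU m C =ᵐ[pathMeasure P] evL m C := by
  rw [IsAlmostClosed, IsTransientSet, IsRegularSet, Ne, pathMeasure_eq_zero, ae_eq_pathMeasure]

/-- Every invariant event is the event of ultimately staying in a suitable set of states. -/
lemma InvEvent.exists_set {P : S → PMF S} {m : ℕ} {A : Set (ℕ → S)} (hm : 1 ≤ m)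
    (hA : InvEvent P m A) :
    ∃ C : Set S, evU m C =ᵐ[pathMeasure P] A ∧ evL m C =ᵐ[pathMeasure P] A := by
  -- Any threshold strictly between the two possible limits 0 and 1 would do.
  refine ⟨{i | 1 / 2 < (pathLaw P i).real A}, ?_⟩
  set C : Set S := {i | 1 / 2 < (pathLaw P i).real A}
  have h1 : A ≤ᵐ[pathMeasure P] evL m C := by
    filter_upwards [hA.tendsto_indicator hm] with x hx (hxA : x ∈ A)
    rw [Set.indicator_of_mem hxA] at hx
    have := hx.eventually (lt_mem_nhds (by norm_num : (1 / 2 : ℝ) < 1))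
    exact eventually_atTop.1 this
  have h2 : evU m C ≤ᵐ[pathMeasure P] A := by
    filter_upwards [hA.tendsto_indicator hm] with x hx (hxU : x ∈ evU m C)
    by_contra hxA
    rw [Set.indicator_of_notMem hxA] at hx
    obtain ⟨a, ha⟩ := eventually_atTop.1 (hx.eventually (gt_mem_nhds (by norm_num : (0 : ℝ) < 1 / 2)))
    obtain ⟨k, hk, hk'⟩ := hxU a
    exact lt_asymm (ha k hk) hk'
  have h3 : evL m C ≤ᵐ[pathMeasure P] evU m C := (evL_subset_evU m C).eventuallyLE
  exact ⟨h2.antisymm (h1.trans h3), (h3.trans h2).antisymm h1⟩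

/-- Intersecting the set representing `A` with `B` loses nothing, since almost every path in `A`
ultimately stays in `B`. -/
lemma InvEvent.exists_subset {P : S → PMF S} {m : ℕ} {A : Set (ℕ → S)} (hm : 1 ≤ m)
    (hA : InvEvent P m A) (hA0 : pathMeasure P A ≠ 0) {B : Set S} (hB : IsAlmostClosed P m B)
    (hAB : A ≤ᵐ[pathMeasure P] evU m B) :
    ∃ C ⊆ B, IsAlmostClosed P m C ∧ evU m C =ᵐ[pathMeasure P] A := by
  obtain ⟨C, hU, hL⟩ := hA.exists_set hm
  obtain ⟨-, hB⟩ := isAlmostClosed_iff.1 hB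
  have h1 : A ≤ᵐ[pathMeasure P] evL m (C ∩ B) := by
    rw [← evL_inter]
    filter_upwards [hL.mem_iff, hB.mem_iff, hAB] with x h1 h2 h3 (hx : x ∈ A)
    exact ⟨h1.2 hx, h2.1 (h3 hx)⟩
  have h2 : evU m (C ∩ B) ≤ᵐ[pathMeasure P] A :=
    (evU_mono m Set.inter_subset_left).eventuallyLE.trans hU.le
  have h3 : evL m (C ∩ B) ≤ᵐ[pathMeasure P] evU m (C ∩ B) := (evL_subset_evU m _).eventuallyLE
  have hUA := h2.antisymm (h1.trans h3)
  refine ⟨C ∩ B, Set.inter_subset_right, isAlmostClosed_iff.2 ⟨?_, ?_⟩, hUA⟩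
  · rwa [measure_congr hUA]
  · exact hUA.trans ((h3.trans h2).antisymm h1).symm

end Events

/-! ### Consequences of irreducibility and aperiodicity -/

section Positivity

variable {S : Type*}

lemma nStep_add (P : S → PMF S) (a b : ℕ) (i : S) :
    nStep P (a + b) i = (nStep P a i).bind (nStep P b) := by
  induction b with
  | zero => simp [nStep]
  | succ b ih =>
    change (nStep P (a + b) i).bind P = _
    rw [ih, PMF.bind_bind]
    rfl

lemma nStep_pos_add {P : S → PMF S} {a b : ℕ} {i j k : S} (h : 0 < nStep P a i j)
    (h' : 0 < nStep P b j k) : 0 < nStep P (a + b) i k := by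
  rw [pos_iff_ne_zero, ← PMF.mem_support_iff] at *
  rw [nStep_add, PMF.mem_support_bind_iff]
  exact ⟨j, h, h'⟩

/-- Return times form an additive submonoid of `ℕ` with gcd 1, which contains all large integers. -/
lemma eventually_nStep_self_pos {P : S → PMF S} (haper : IsAperiodic P) (i : S) :
    ∃ N : ℕ, ∀ n ≥ N, 0 < nStep P n i i := by
  set R : AddSubmonoid ℕ :=
    { carrier := {n | 0 < nStep P n i i}
      zero_mem' := by simp [nStep]
      add_mem' := fun ha hb => nStep_pos_add ha hb }
  obtain ⟨N, hN⟩ := Nat.exists_mem_closure_of_ge (R : Set ℕ)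
  have h1 : Nat.setGcd (R : Set ℕ) = 1 :=
    haper i _ fun n _ hn => Nat.setGcd_dvd_of_mem hn
  refine ⟨N, fun n hn => ?_⟩
  have := hN n hn (h1 ▸ one_dvd n)
  rw [AddSubmonoid.closure_eq] at this
  exact this

lemma exists_nStep_mul_pos {P : S → PMF S} (hirr : IsIrreducible P) (haper : IsAperiodic P)
    {m : ℕ} (hm : 1 ≤ m) (i j : S) : ∃ k : ℕ, 0 < nStep P (k * m) i j := by
  obtain ⟨N, hN⟩ := eventually_nStep_self_pos haper i
  obtain ⟨a, ha⟩ := hirr i j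
  have h1 : N + a ≤ (N + a) * m := Nat.le_mul_of_pos_right _ hm
  -- Of the `(N + a) * m` steps, the last `a` lead to `j`; the others, at least `N`, form a loop at
  -- `i`.
  refine ⟨N + a, ?_⟩
  have h2 := nStep_pos_add (hN ((N + a) * m - a) (by lia)) ha
  rwa [Nat.sub_add_cancel (by lia)] at h2

end Positivity

/-! ### Return bounds, atoms and orbits of invariant events -/

section Events

variable {S : Type*} [MeasurableSpace S] [DiscreteMeasurableSpace S] [Countable S]

/-- From `i` the chain reaches any `j` at some multiple of `m`, and invariance carries the nullity
over to `j`. -/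
lemma InvEvent.null_of_null {P : S → PMF S} (hirr : IsIrreducible P) (haper : IsAperiodic P)
    {m : ℕ} (hm : 1 ≤ m) {A : Set (ℕ → S)} (hA : InvEvent P m A) {i : S}
    (hi : pathLaw P i A = 0) : pathMeasure P A = 0 := by
  refine pathMeasure_eq_zero.2 fun j => ?_
  obtain ⟨k, hk⟩ := exists_nStep_mul_pos hirr haper hm i j
  have h1 := pathLaw_shift_ge P i (k * m) j hA.meas
  rw [measure_congr ((pathLaw_absolutelyContinuous P i).ae_eq (hA.mul k).inv), hi,
    nonpos_iff_eq_zero, mul_eq_zero] at h1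
  exact h1.resolve_left hk.ne'

/-- If the `n`-step return probabilities are bounded from below off a finite set, then every event
invariant under some shift is almost surely contained in its preimage under the shift by `n`. -/
lemma InvEvent.le_shift {P : S → PMF S} (hirr : IsIrreducible P) (haper : IsAperiodic P)
    {m n : ℕ} (hm : 1 ≤ m) (hn : ReturnBound P n) {A : Set (ℕ → S)} (hA : InvEvent P m A) :
    A ≤ᵐ[pathMeasure P] shift n ⁻¹' A := by
  by_cases hfull : pathMeasure P Aᶜ = 0
  · have h1 := (quasiMeasurePreserving_shift P n).preimage_null hfull
    filter_upwards [measure_eq_zero_iff_ae_notMem.1 h1] with x hx _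
    exact not_not.1 hx
  have hlt : ∀ i, (pathLaw P i).real A < 1 := by
    intro i
    by_contra! h
    refine hfull (hA.compl.null_of_null hirr haper hm (i := i) ?_)
    rw [prob_compl_eq_zero_iff hA.meas]
    have h1 : (pathLaw P i).real A = 1 := le_antisymm measureReal_le_one h
    rw [measureReal_def, ENNReal.toReal_eq_one_iff] at h1
    exact h1
  obtain ⟨δ, hδ, hF⟩ := hn
  -- Truncation at 1 guards against `δ = ∞`, whose `toReal` would be 0.
  have hδ0 : 0 < (min δ 1).toReal :=
    ENNReal.toReal_pos (lt_min hδ one_pos).ne' (min_lt_of_right_lt ENNReal.one_lt_top).ne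
  have hbound : ∀ i, δ ≤ nStep P n i i →
      (min δ 1).toReal * (pathLaw P i).real A ≤ (pathLaw P i).real (shift n ⁻¹' A) := by
    intro i hi
    rw [measureReal_def, measureReal_def, ← ENNReal.toReal_mul]
    refine ENNReal.toReal_mono (measure_ne_top _ _) ?_
    refine le_trans ?_ (pathLaw_shift_ge P i n i hA.meas)
    gcongr
    exact (min_le_left _ _).trans hi
  filter_upwards [hA.tendsto_indicator hm, (hA.preimage_shift n).tendsto_indicator hm]
    with x h1 h2 (hxA : x ∈ A)
  by_contra hxA'
  rw [Set.indicator_of_mem hxA] at h1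
  rw [Set.indicator_of_notMem (show x ∉ shift n ⁻¹' A from hxA')] at h2
  -- On `A` the probabilities tend to 1, while each exceptional state has probability below 1; so
  -- each is eventually avoided.
  have h3 : ∀ᶠ k : ℕ in atTop, ∀ i ∈ {i : S | ¬ δ ≤ nStep P n i i}, x (k * m) ≠ i := by
    refine (eventually_all_finite hF).2 fun i _ => ?_
    filter_upwards [h1.eventually (lt_mem_nhds (hlt i))] with k hk hki
    rw [hki] at hk
    exact lt_irrefl _ hk
  have h4 : (min δ 1).toReal * 1 ≤ 0 := by
    refine le_of_tendsto_of_tendsto (h1.const_mul _) h2 ?_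
    filter_upwards [h3] with k hk
    refine hbound _ ?_
    by_contra hcon
    exact hk _ hcon rfl
  linarith

lemma InvEvent.of_returnBound {P : S → PMF S} (hirr : IsIrreducible P) (haper : IsAperiodic P)
    {m n : ℕ} (hm : 1 ≤ m) (hn : ReturnBound P n) {A : Set (ℕ → S)} (hA : InvEvent P m A) :
    InvEvent P n A := by
  refine ⟨hA.meas, EventuallyLE.antisymm ?_ (hA.le_shift hirr haper hm hn)⟩
  -- The reverse inclusion is `le_shift` for the complement.
  filter_upwards [hA.compl.le_shift hirr haper hm hn] with x hx (hx' : shift n x ∈ A)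
  by_contra hxA
  exact hx hxA hx'

/-- `A` is an atom among the events invariant under the shift by `m`. -/
structure IsAtomEvent (P : S → PMF S) (m : ℕ) (A : Set (ℕ → S)) : Prop where
  inv : InvEvent P m A
  ne_zero : pathMeasure P A ≠ 0
  atom : ∀ B, InvEvent P m B → pathMeasure P (A ∩ B) = 0 ∨ pathMeasure P (A \ B) = 0

omit [Countable S] in
lemma IsAtomEvent.congr {P : S → PMF S} {m : ℕ} {A B : Set (ℕ → S)} (hA : IsAtomEvent P m A)
    (hB : InvEvent P m B) (h : A =ᵐ[pathMeasure P] B) : IsAtomEvent P m B := by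
  refine ⟨hB, by rw [← measure_congr h]; exact hA.ne_zero, fun D hD => ?_⟩
  rw [← measure_congr (h.inter (.refl _ D)), ← measure_congr (h.diff (.refl _ D))]
  exact hA.atom D hD

lemma IsAlmostClosed.diff {P : S → PMF S} {m : ℕ} {B C : Set S} (hB : IsAlmostClosed P m B)
    (hC : IsAlmostClosed P m C) (h : pathMeasure P (evU m B \ evU m C) ≠ 0) :
    IsAlmostClosed P m (B \ C) := by
  obtain ⟨-, hB⟩ := isAlmostClosed_iff.1 hB
  obtain ⟨-, hC⟩ := isAlmostClosed_iff.1 hC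
  have h1 : evU m B \ evU m C ≤ᵐ[pathMeasure P] evL m (B \ C) := by
    filter_upwards [hB.mem_iff] with x hx (hx' : x ∈ evU m B \ evU m C)
    obtain ⟨a, ha⟩ := hx.1 hx'.1
    have h2 : ∃ b, ∀ k, b ≤ k → x (k * m) ∉ C := by
      by_contra! hcon
      exact hx'.2 hcon
    obtain ⟨b, hb⟩ := h2
    exact ⟨max a b, fun k hk => ⟨ha k (le_of_max_le_left hk), hb k (le_of_max_le_right hk)⟩⟩
  have h2 : evU m (B \ C) ≤ᵐ[pathMeasure P] evU m B \ evU m C := by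
    filter_upwards [hC.mem_iff] with x hx (hx' : x ∈ evU m (B \ C))
    refine ⟨evU_mono m Set.sdiff_subset hx', fun hxC => ?_⟩
    obtain ⟨a, ha⟩ := hx.1 hxC
    obtain ⟨k, hk, hk'⟩ := hx' a
    exact hk'.2 (ha k hk)
  have h3 : evL m (B \ C) ≤ᵐ[pathMeasure P] evU m (B \ C) := (evL_subset_evU m _).eventuallyLE
  refine isAlmostClosed_iff.2 ⟨?_, (h2.trans h1).antisymm h3⟩
  rwa [measure_congr (h2.antisymm (h1.trans h3))]

/-- An invariant event splitting `evU m B` would be realised by an almost closed `C ⊆ B`, with `B \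
C` almost closed as well. -/
lemma IsAtomicSet.isAtomEvent {P : S → PMF S} {m : ℕ} (hm : 1 ≤ m) {B : Set S}
    (hB : IsAtomicSet P m B) : IsAtomEvent P m (evU m B) := by
  refine ⟨invEvent_evU P m B, (isAlmostClosed_iff.1 hB.1).1, fun D hD => ?_⟩
  by_contra! hcon
  obtain ⟨C, hCB, hC, hCU⟩ := ((invEvent_evU P m B).inter hD).exists_subset hm hcon.1 hB.1
    Set.inter_subset_left.eventuallyLE
  refine hB.2 ⟨C, B \ C, hCB, Set.sdiff_subset, Set.disjoint_sdiff_right, hC, hB.1.diff hC ?_⟩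
  rw [measure_congr ((EventuallyEq.refl _ (evU m B)).diff hCU), Set.sdiff_self_inter]
  exact hcon.2

lemma measure_evU_inter_evU {P : S → PMF S} {m : ℕ} {A B : Set S} (hA : IsAlmostClosed P m A)
    (hB : IsAlmostClosed P m B) (h : Disjoint A B) :
    pathMeasure P (evU m A ∩ evU m B) = 0 := by
  rw [measure_congr ((isAlmostClosed_iff.1 hA).2.inter (isAlmostClosed_iff.1 hB).2), evL_inter,
    h.inter_eq]
  convert measure_empty (μ := pathMeasure P)
  refine Set.eq_empty_of_forall_notMem fun x ⟨n, hn⟩ => hn n le_rfl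

lemma IsAtomEvent.isAtomicSet {P : S → PMF S} {m : ℕ} {B : Set S}
    (hB : IsAlmostClosed P m B) (h : IsAtomEvent P m (evU m B)) : IsAtomicSet P m B := by
  refine ⟨hB, ?_⟩
  rintro ⟨A, C, hAB, hCB, hAC, hA, hC⟩
  rcases h.atom _ (invEvent_evU P m A) with h1 | h1
  · rw [Set.inter_eq_right.2 (evU_mono m hAB)] at h1
    exact (isAlmostClosed_iff.1 hA).1 h1
  · refine (isAlmostClosed_iff.1 hC).1 (measure_mono_null (t :=
      (evU m A ∩ evU m C) ∪ (evU m B \ evU m A)) (fun x hx => ?_)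
      (measure_union_null (measure_evU_inter_evU hA hC hAC) h1))
    by_cases hxA : x ∈ evU m A
    · exact Or.inl ⟨hxA, hx⟩
    · exact Or.inr ⟨evU_mono m hCB hx, hxA⟩

/-- The union of the first `m` shifted copies of an event. -/
def orbit (m : ℕ) (A : Set (ℕ → S)) : Set (ℕ → S) := {x | ∃ j < m, shift j x ∈ A}

omit [Countable S] in
lemma InvEvent.orbit {P : S → PMF S} {m : ℕ} {A : Set (ℕ → S)} (hA : InvEvent P m A) :
    InvEvent P 1 (orbit m A) := by
  constructor
  · have : AsymptoticPeriod.orbit m A = ⋃ j : ℕ, ⋃ _ : j < m, shift j ⁻¹' A := by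
      ext x; simp [AsymptoticPeriod.orbit]
    rw [this]
    exact .iUnion fun j => .iUnion fun _ => measurable_shift j hA.meas
  · have key : ∀ (j : ℕ) (x : ℕ → S), shift j (shift 1 x) ∈ A ↔ shift (j + 1) x ∈ A := fun j x =>
      Set.ext_iff.1 (shift_preimage_shift 1 j A) x
    refine eventuallyEq_set.2 ?_
    filter_upwards [hA.inv.mem_iff] with x (hx : shift m x ∈ A ↔ x ∈ A)
    constructor
    · rintro ⟨j, hj, hj'⟩
      rw [key] at hj'
      rcases Nat.lt_or_ge (j + 1) m with h | h
      · exact ⟨j + 1, h, hj'⟩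
      -- The last copy wraps around to the first by invariance under `m`.
      · obtain rfl : m = j + 1 := by lia
        exact ⟨0, by lia, (shift_zero x).symm ▸ hx.1 hj'⟩
    · rintro ⟨j, hj, hj'⟩
      rcases j with _ | j
      · rw [shift_zero, ← hx] at hj'
        obtain ⟨l, rfl⟩ : ∃ l, m = l + 1 := ⟨m - 1, by lia⟩
        exact ⟨l, by lia, (key l x).2 hj'⟩
      · exact ⟨j, by lia, (key j x).2 hj'⟩

omit [MeasurableSpace S] [DiscreteMeasurableSpace S] [Countable S] in
lemma subset_orbit {m : ℕ} (hm : 1 ≤ m) (A : Set (ℕ → S)) : A ⊆ orbit m A := fun x hx =>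
  ⟨0, hm, (shift_zero x).symm ▸ hx⟩

lemma orbit_inter_null {P : S → PMF S} {m : ℕ} {A D : Set (ℕ → S)} (hD : InvEvent P 1 D)
    (h : pathMeasure P (A ∩ D) = 0) : pathMeasure P (orbit m A ∩ D) = 0 := by
  have h1 : ∀ᵐ x ∂pathMeasure P, ∀ j : ℕ, shift j x ∉ A ∩ D := ae_all_iff.2 fun j =>
    measure_eq_zero_iff_ae_notMem.1 ((quasiMeasurePreserving_shift P j).preimage_null h)
  have h2 : ∀ᵐ x ∂pathMeasure P, ∀ j : ℕ, shift j x ∈ D ↔ x ∈ D := ae_all_iff.2 fun j =>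
    (hD.of_dvd (one_dvd j)).inv.mem_iff
  refine measure_eq_zero_iff_ae_notMem.2 ?_
  filter_upwards [h1, h2] with x h1 h2
  rintro ⟨⟨j, -, hj⟩, hx⟩
  exact h1 j ⟨hj, (h2 j).2 hx⟩

lemma IsAtomEvent.orbit {P : S → PMF S} {m : ℕ} (hm : 1 ≤ m) {A : Set (ℕ → S)}
    (hA : IsAtomEvent P m A) : IsAtomEvent P 1 (orbit m A) :=
  ⟨hA.inv.orbit, fun h => hA.ne_zero (measure_mono_null (subset_orbit hm A) h), fun D hD =>
    (hA.atom D (hD.of_dvd (one_dvd m))).imp (orbit_inter_null hD) (orbit_inter_null hD.compl)⟩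

/-- If the shift-invariant events are trivial, there are at most `g` almost disjoint nonnull events
invariant under the shift by `g`. -/
lemma card_le_of_disjoint_invEvents {P : S → PMF S} (h1 : IsAtomEvent P 1 Set.univ) {g : ℕ}
    (hg : 1 ≤ g) {ι : Type*} [Fintype ι] (f : ι → Set (ℕ → S)) (hf : ∀ k, InvEvent P g (f k))
    (hf0 : ∀ k, pathMeasure P (f k) ≠ 0)
    (hdisj : ∀ k l, k ≠ l → pathMeasure P (f k ∩ f l) = 0) : Fintype.card ι ≤ g := by
  have hcover : ∀ᵐ x ∂pathMeasure P, ∀ k, ∃ j < g, shift j x ∈ f k := by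
    refine eventually_all.2 fun k => ?_
    rcases h1.atom _ (hf k).orbit with h | h
    · rw [Set.univ_inter] at h
      exact absurd (measure_mono_null (subset_orbit hg _) h) (hf0 k)
    · filter_upwards [measure_eq_zero_iff_ae_notMem.1 h] with x hx
      by_contra hcon
      exact hx ⟨trivial, hcon⟩
  have hinj : ∀ᵐ x ∂pathMeasure P, ∀ (j : ℕ) (k l : ι), k ≠ l → shift j x ∉ f k ∩ f l := by
    refine ae_all_iff.2 fun j => eventually_all.2 fun k => eventually_all.2 fun l => ?_
    by_cases hkl : k = l
    · simp [hkl]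
    · filter_upwards [measure_eq_zero_iff_ae_notMem.1
        ((quasiMeasurePreserving_shift P j).preimage_null (hdisj k l hkl))] with x hx _
      exact hx
  have hne : (ae (pathMeasure P)).NeBot := by
    rw [ae_neBot]
    rintro h
    exact h1.ne_zero (by simp [h])
  obtain ⟨x, hx1, hx2⟩ := (hcover.and hinj).exists
  -- On one generic path, each event is entered at some time below `g`; disjointness forbids shared
  -- times, so pigeonhole applies.
  choose j hj hj' using hx1
  have : Function.Injective (fun k => (⟨j k, hj k⟩ : Fin g)) := by
    intro k l hkl
    by_contra hne
    have hjkl : j k = j l := congrArg Fin.val hkl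
    exact hx2 (j k) k l hne ⟨hj' k, hjkl ▸ hj' l⟩
  simpa using Fintype.card_le_of_injective _ this

omit [Countable S] in
/-- Without atoms, nonnull invariant events split into arbitrarily many nonnull pieces. -/
lemma exists_disjoint_invEvents {P : S → PMF S} {m : ℕ} (h : ∀ A, ¬ IsAtomEvent P m A) (N : ℕ)
    {A : Set (ℕ → S)} (hA : InvEvent P m A) (hA0 : pathMeasure P A ≠ 0) :
    ∃ f : Fin (N + 1) → Set (ℕ → S), (∀ k, f k ⊆ A) ∧ (∀ k, InvEvent P m (f k)) ∧
      (∀ k, pathMeasure P (f k) ≠ 0) ∧ ∀ k l, k ≠ l → Disjoint (f k) (f l) := by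
  induction N generalizing A with
  | zero =>
    exact ⟨fun _ => A, fun _ => subset_rfl, fun _ => hA, fun _ => hA0,
      fun k l hkl => absurd (Fin.ext (by lia)) hkl⟩
  | succ N ih =>
    obtain ⟨B, hB, hB1, hB2⟩ : ∃ B, InvEvent P m B ∧ pathMeasure P (A ∩ B) ≠ 0 ∧
        pathMeasure P (A \ B) ≠ 0 := by
      by_contra! hcon
      exact h A ⟨hA, hA0, fun B hB => or_iff_not_imp_left.2 (hcon B hB)⟩
    obtain ⟨f, hf1, hf2, hf3, hf4⟩ := ih (hA.inter hB) hB1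
    have hd : ∀ k, Disjoint (A \ B) (f k) := fun k =>
      Set.disjoint_left.2 fun x hx hx' => hx.2 (hf1 k hx').2
    refine ⟨Fin.cons (A \ B) f, ?_, ?_, ?_, ?_⟩
    · exact Fin.cases Set.sdiff_subset fun k => (hf1 k).trans Set.inter_subset_left
    · exact Fin.cases (hA.diff hB) hf2
    · exact Fin.cases hB2 hf3
    · refine Fin.cases (Fin.cases (fun h => absurd rfl h) fun l _ => hd l) fun k =>
        Fin.cases (fun _ => (hd k).symm) fun l hkl => hf4 k l fun h => hkl (by rw [h])

end Events

/-! ### Simple chains and the asymptotic period -/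

section Period

variable {S : Type*} [MeasurableSpace S] [DiscreteMeasurableSpace S] [Countable S]

omit [Countable S] in
lemma exists_decomposition {P : S → PMF S} {m c : ℕ} (h : beta P m = (c : ℕ∞)) :
    ∃ 𝒞 : Set (Set S), IsBlackwellDecomposition P m 𝒞 ∧ 𝒞.encard = (c : ℕ∞) := by
  rw [beta, iInf_subtype'] at h
  cases isEmpty_or_nonempty {𝒞 : Set (Set S) // IsBlackwellDecomposition P m 𝒞} with
  | inl hE =>
    rw [iInf_of_empty] at h
    exact absurd h.symm (ENat.natCast_ne_top c)
  | inr hE =>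
    obtain ⟨𝒞, h𝒞⟩ := ciInf_mem
      (fun 𝒞 : {𝒞 : Set (Set S) // IsBlackwellDecomposition P m 𝒞} => 𝒞.1.encard)
    exact ⟨𝒞.1, 𝒞.2, h𝒞.trans h⟩

/-- The only Blackwell set carries full measure. If it is nonatomic, any atom would be realised by
an atomic subset of it, which is forbidden. -/
lemma IsSimple.atom_univ_or_no_atom {P : S → PMF S} {m : ℕ} (hm : 1 ≤ m) (h : IsSimple P m) :
    IsAtomEvent P m Set.univ ∨ ∀ A, ¬ IsAtomEvent P m A := by
  obtain ⟨𝒞, h𝒞, hcard⟩ := exists_decomposition (c := 1) (by exact_mod_cast h)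
  obtain ⟨C, rfl⟩ := Set.encard_eq_one.1 (by exact_mod_cast hcard)
  have hC := h𝒞.almostClosed C rfl
  have hU : evU m C =ᵐ[pathMeasure P] Set.univ := by
    refine (isAlmostClosed_iff.1 hC).2.trans (ae_eq_pathMeasure.2 fun i => ?_)
    have h1 := h𝒞.sum_eq_one i
    rw [tsum_singleton C (f := fun D => pathLaw P i (evL m D))] at h1
    refine ae_eq_univ_iff_measure_eq ?_ |>.2 (by rw [h1, measure_univ])
    exact ((measurableSet_evU m C).nullMeasurableSet.congr
      ((pathLaw_absolutelyContinuous P i).ae_eq (isAlmostClosed_iff.1 hC).2))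
  by_cases hat : IsAtomicSet P m C
  · exact Or.inl ((hat.isAtomEvent hm).congr .univ hU)
  · refine Or.inr fun A hA => ?_
    obtain ⟨D, hDC, hD, hDA⟩ := hA.inv.exists_subset hm hA.ne_zero hC
      ((Set.subset_univ A).eventuallyLE.trans hU.symm.le)
    exact (h𝒞.nonatomic C rfl hat).1 D hDC ((hA.congr (invEvent_evU P m D) hDA.symm).isAtomicSet hD)

lemma IsBlackwellDecomposition.exists_atomEvent {P : S → PMF S} {m : ℕ} (hm : 1 ≤ m)
    {𝒞 : Set (Set S)} (h : IsBlackwellDecomposition P m 𝒞) (hcard : 1 < 𝒞.encard) :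
    ∃ A, IsAtomEvent P m A := by
  obtain ⟨C, D, hC, hD, hCD⟩ := Set.one_lt_encard_iff.1 hcard
  by_cases hat : IsAtomicSet P m C
  · exact ⟨_, hat.isAtomEvent hm⟩
  · by_cases hat' : IsAtomicSet P m D
    · exact ⟨_, hat'.isAtomEvent hm⟩
    · exact absurd (h.atomic C hC D hD hat hat') hCD

/-- Of two Blackwell sets one is atomic, and the orbit of its event is an atom for the one-step
shift, which rules out the atomless alternative. -/
lemma IsSimple.atom_univ_of_beta {P : S → PMF S} (h : IsSimple P 1) {m : ℕ} (hm : 2 ≤ m)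
    (hβ : beta P m = (m : ℕ∞)) : IsAtomEvent P 1 Set.univ := by
  obtain ⟨𝒞, h𝒞, hcard⟩ := exists_decomposition hβ
  obtain ⟨A, hA⟩ := h𝒞.exists_atomEvent (by lia) (by rw [hcard]; exact_mod_cast hm)
  exact (h.atom_univ_or_no_atom le_rfl).resolve_right fun h' => h' _ (hA.orbit (by lia))

lemma dvd_of_beta_eq {P : S → PMF S} (hirr : IsIrreducible P) (haper : IsAperiodic P)
    (h : IsSimple P 1) {n : ℕ} (hn : ReturnBound P n) {m : ℕ} (hm : 1 ≤ m)
    (hβ : beta P m = (m : ℕ∞)) : m ∣ n := by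
  rcases hm.eq_or_lt with rfl | hm2
  · exact one_dvd n
  have h1 := h.atom_univ_of_beta hm2 hβ
  obtain ⟨𝒞, h𝒞, hcard⟩ := exists_decomposition hβ
  have hfin : 𝒞.Finite := Set.finite_of_encard_eq_coe hcard
  have : Fintype 𝒞 := hfin.fintype
  have hle : Fintype.card 𝒞 ≤ m.gcd n := by
    refine card_le_of_disjoint_invEvents h1 (Nat.gcd_pos_of_pos_left n hm)
      (fun C : 𝒞 => evU m C.1) (fun C => ?_)
      (fun C => (isAlmostClosed_iff.1 (h𝒞.almostClosed C.1 C.2)).1) fun C D hCD => ?_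
    · have hC := invEvent_evU P m C.1
      exact hC.gcd (hC.of_returnBound hirr haper hm hn)
    · exact measure_evU_inter_evU (h𝒞.almostClosed C.1 C.2) (h𝒞.almostClosed D.1 D.2)
        (h𝒞.disjoint C.2 D.2 fun h => hCD (Subtype.ext h))
  have hm' : Fintype.card 𝒞 = m := by
    rw [Set.encard_eq_coe_toFinset_card, Set.toFinset_card] at hcard
    exact_mod_cast hcard
  rw [hm'] at hle
  exact Nat.gcd_eq_left_iff_dvd.1 (le_antisymm (Nat.gcd_le_left n hm) hle)

lemma exists_asymptoticPeriod_eq {P : S → PMF S} (hirr : IsIrreducible P) (haper : IsAperiodic P)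
    (h : IsSimple P 1) {n : ℕ} (hn1 : 1 ≤ n) (hn : ReturnBound P n) :
    ∃ d : ℕ, 1 ≤ d ∧ asymptoticPeriod P = (d : ℕ∞) ∧ beta P d = (d : ℕ∞) ∧ d ∣ n := by
  classical
  have h1 : 1 ≤ 1 ∧ beta P 1 = ((1 : ℕ) : ℕ∞) := ⟨le_rfl, by exact_mod_cast h⟩
  -- All candidates divide `n`, so the supremum is a maximum over `m ≤ n`; 1 is a candidate because
  -- the chain is simple.
  obtain ⟨hd1, hd2⟩ := Nat.findGreatest_spec (P := fun m => 1 ≤ m ∧ beta P m = (m : ℕ∞)) hn1 h1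
  refine ⟨_, hd1, le_antisymm (iSup₂_le fun m hm => ?_) (le_iSup₂_of_le _ ⟨hd1, hd2⟩ le_rfl), hd2,
    dvd_of_beta_eq hirr haper h hn hd1 hd2⟩
  exact Nat.cast_le.2 (Nat.le_findGreatest
    (Nat.le_of_dvd hn1 (dvd_of_beta_eq hirr haper h hn hm.1 hm.2)) hm)

lemma isAsymptoticallyAperiodic_of_isSimple {P : S → PMF S} (hirr : IsIrreducible P)
    (haper : IsAperiodic P) (h : IsSimple P 1) {n : ℕ} (hn1 : 1 ≤ n) (hn : ReturnBound P n)
    (hsn : IsSimple P n) : IsAsymptoticallyAperiodic P := by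
  obtain ⟨d, hd1, hd, hβ, hdn⟩ := exists_asymptoticPeriod_eq hirr haper h hn1 hn
  rw [IsAsymptoticallyAperiodic, hd]
  rcases hd1.eq_or_lt with rfl | hd2
  · rfl
  exfalso
  have h1 := h.atom_univ_of_beta hd2 hβ
  rcases hsn.atom_univ_or_no_atom hn1 with h2 | h2
  · obtain ⟨𝒞, h𝒞, hcard⟩ := exists_decomposition hβ
    obtain ⟨C, D, hC, hD, hCD⟩ :=
      Set.one_lt_encard_iff.1 (show 1 < 𝒞.encard by rw [hcard]; exact_mod_cast hd2)
    have hC' := h𝒞.almostClosed C hC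
    have hD' := h𝒞.almostClosed D hD
    rcases h2.atom _ ((invEvent_evU P d C).of_dvd hdn) with h3 | h3
    · exact (isAlmostClosed_iff.1 hC').1 (by rwa [Set.univ_inter] at h3)
    · refine (isAlmostClosed_iff.1 hD').1 (measure_mono_null (fun x hx => ?_)
        (measure_union_null (measure_evU_inter_evU hC' hD' (h𝒞.disjoint hC hD hCD)) h3))
      by_cases hxC : x ∈ evU d C
      · exact Or.inl ⟨hxC, hx⟩
      · exact Or.inr ⟨trivial, hxC⟩
  -- Splitting into `n + 1` pieces exceeds the bound `n` by one.
  · obtain ⟨f, -, hf, hf0, hdisj⟩ := exists_disjoint_invEvents h2 n .univ h1.ne_zero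
    have := card_le_of_disjoint_invEvents h1 hn1 f hf hf0 fun k l hkl => by
      rw [(hdisj k l hkl).inter_eq, measure_empty]
    rw [Fintype.card_fin] at this
    lia

end Period

end AsymptoticPeriod

theorem mainTheorem8 {S : Type*} [Countable S] [Infinite S]
    [MeasurableSpace S] [DiscreteMeasurableSpace S] (P : S → PMF S)
    (hirr : AsymptoticPeriod.IsIrreducible P) (haper : AsymptoticPeriod.IsAperiodic P)
    (hsimple : AsymptoticPeriod.IsSimple P 1) :
    (∀ n : ℕ, 1 ≤ n → AsymptoticPeriod.ReturnBound P n →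
      ∃ d : ℕ, AsymptoticPeriod.asymptoticPeriod P = (d : ℕ∞) ∧ d ∣ n) ∧
    ((∃ δ : ENNReal, 0 < δ ∧ {i : S | ¬ δ ≤ P i i}.Finite) →
      AsymptoticPeriod.IsAsymptoticallyAperiodic P) ∧
    (∀ n : ℕ, 1 ≤ n → AsymptoticPeriod.ReturnBound P n → AsymptoticPeriod.IsSimple P n →
      AsymptoticPeriod.IsAsymptoticallyAperiodic P) := by
  refine ⟨fun n hn1 hn => ?_, fun ⟨δ, hδ, hF⟩ => ?_, fun n hn1 hn hsn => ?_⟩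
  · obtain ⟨d, -, hd, -, hdn⟩ :=
      AsymptoticPeriod.exists_asymptoticPeriod_eq hirr haper hsimple hn1 hn
    exact ⟨d, hd, hdn⟩
  · refine AsymptoticPeriod.isAsymptoticallyAperiodic_of_isSimple hirr haper hsimple le_rfl
      ⟨δ, hδ, ?_⟩ hsimple
    simpa [AsymptoticPeriod.nStep] using hF
  · exact AsymptoticPeriod.isAsymptoticallyAperiodic_of_isSimple hirr haper hsimple hn1 hn hsn
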